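/- Let $F$ be a field. Let $\mathrm{Zar}(F)$ be the set of valuation rings of $F$, i.e. of subrings $V \subseteq F$ such that $t \in V$ or $t^{-1} \in V$ for each $0 \neq t \in F$; the maximal ideal of $V$ is denoted $\mathfrak{M}_V$. The patch topology on $\mathrm{Zar}(F)$ has as a basis of open sets the sets $\{V \in \mathrm{Zar}(F) : x_1,\dots,x_n \in V,\ y_1,\dots,y_m \notin V\}$ with $n, m \ge 0$ and $x_1,\dots,x_n,y_1,\dots,y_m \in F$. For $X \subseteq \mathrm{Zar}(F)$ put $A(X) = \bigcap_{V \in X} V$ and $J(X) = \bigcap_{V \in X} \mathfrak{M}_V$ (an empty intersection being $F$), and let $\lim(X)$ be the set of limit points of $X$ in the patch topology, i.e. of those $U \in \mathrm{Zar}(F)$ such that every patch open neighborhood of $U$ contains an element of $X$ distinct from $U$. A set $X \subseteq \mathrm{Zar}(F)$ is a representation of a subring $A$ of $F$ if $A = A(X)$. A subring $A$ of $F$ with quotient field $Q(A) \subseteq F$ is completely integrally closed if $A$ contains every $t \in Q(A)$ for which there is $0 \neq a \in A$ with $a t^n \in A$ for all $n > 0$. Suppose that $F$ is countable and that $A$ is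 a completely integrally closed local subring of $F$ that is not a valuation ring of $F$. If $X \subseteq \mathrm{Zar}(F)$ is a representation of $A$ such that $J(X) \neq 0$, then there is a set $Y \subseteq \lim(X)$ that is closed in the patch topology of $\mathrm{Zar}(F)$, is a representation of $A$, and is homeomorphic, in the subspace topology induced by the patch topology, to the Cantor set. -/

import Mathlib

namespace ZariskiRiemann

/-- The patch topology on the set `Zar(F)` of valuation rings of the field `F`: the basic open sets
are the sets `{V : x₁, …, xₙ ∈ V, y₁, …, yₘ ∉ V}` with `x₁, …, xₙ, y₁, …, yₘ ∈ F`. -/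
instance patchTopology (F : Type*) [Field F] : TopologicalSpace (ValuationSubring F) :=
  TopologicalSpace.generateFrom
    {U | ∃ S T : Finset F, U = {V : ValuationSubring F | (∀ x ∈ S, x ∈ V) ∧ ∀ y ∈ T, y ∉ V}}

/-- `lim(X)`: the set of limit points of `X` in the patch topology. -/
def lim {F : Type*} [Field F] (X : Set (ValuationSubring F)) : Set (ValuationSubring F) :=
  derivedSet X

/-- `A(X)`: the intersection of the valuation rings in `X`. -/
def A {F : Type*} [Field F] (X : Set (ValuationSubring F)) : Subring F :=
  ⨅ V ∈ X, V.toSubring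

/-- `J(X)`: the intersection in `F` of the maximal ideals of the valuation rings in `X`. -/
def J {F : Type*} [Field F] (X : Set (ValuationSubring F)) : NonUnitalSubring F :=
  ⨅ V ∈ X, V.nonunits

/-- `X` is a representation of the subring `R` of `F` if `R = A(X)`. -/
def IsRepresentation {F : Type*} [Field F] (X : Set (ValuationSubring F)) (R : Subring F) : Prop :=
  R = A X

/-- `R` is completely integrally closed: every element of the quotient field of `R` (computed
inside `F`) that is almost integral over `R` lies in `R`. -/
def IsCompletelyIntegrallyClosed {F : Type*} [Field F] (R : Subring F) : Prop :=
  ∀ t : F, t ∈ Subfield.closure (R : Set F) → IsAlmostIntegral R t → t ∈ R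

/-- `R` is a valuation ring of `F`: `t ∈ R` or `t⁻¹ ∈ R` for every `0 ≠ t ∈ F`. -/
def IsValuationRingOf {F : Type*} [Field F] (R : Subring F) : Prop :=
  ∃ V : ValuationSubring F, V.toSubring = R

end ZariskiRiemann

/-! No single point of a representation with `J ≠ 0` is needed. If `b` lies in every member of `X`
except perhaps `V`, and `0 ≠ t ∈ J X`, locality forces `t * b ^ n ∈ V` for all `n`
(`mul_pow_mem_of_mem_diff`), so `b` is almost integral over `R` and hence in `R`. Thus finite
subsets can be discarded, and by compactness of the patch topology `lim X` represents `R` again. A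
minimal closed representation inside `lim X` then equals its own derived set, so it is perfect. As
`F` is countable, countably many clopen sets separate its points, which makes it a Cantor set. -/

open Set Filter Topology

/-! ### Topological characterization of the Cantor space. -/

section CantorSpace

variable {K : Type*}

open Classical in
/-- The element of the `n`-th partition containing `y`, where the partition is successively refined
by the splitting function `S`. -/
noncomputable def splitCell (S : ℕ → Set K → Set K) (y : K) : ℕ → Set K
  | 0 => univ
  | n + 1 =>
    if y ∈ S n (splitCell S y n) then splitCell S y n ∩ S n (splitCell S y n)
    else splitCell S y n \ S n (splitCell S y n)

/-- The cell reached by following the branch `x` of the tree of the splitting function `S`. -/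
noncomputable def branchCell (S : ℕ → Set K → Set K) (x : ℕ → Bool) : ℕ → Set K
  | 0 => univ
  | n + 1 =>
    if x n then branchCell S x n ∩ S n (branchCell S x n)
    else branchCell S x n \ S n (branchCell S x n)

open Classical in
/-- The branch of the tree of the splitting function `S` followed by the point `y`. -/
noncomputable def splitCode (S : ℕ → Set K → Set K) (y : K) (n : ℕ) : Bool :=
  decide (y ∈ S n (splitCell S y n))

theorem mem_splitCell (S : ℕ → Set K → Set K) (y : K) (n : ℕ) : y ∈ splitCell S y n := by
  induction n with
  | zero => exact mem_univ y
  | succ n ih =>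
    rw [splitCell]
    split_ifs with h
    exacts [⟨ih, h⟩, ⟨ih, h⟩]

theorem branchCell_splitCode (S : ℕ → Set K → Set K) (y : K) (n : ℕ) :
    branchCell S (splitCode S y) n = splitCell S y n := by
  induction n with
  | zero => rfl
  | succ n ih =>
    rw [branchCell, splitCell, ih, splitCode]
    by_cases h : y ∈ S n (splitCell S y n) <;> simp [h]

theorem splitCell_eq_of_mem (S : ℕ → Set K → Set K) {y z : K} {n : ℕ}
    (h : z ∈ splitCell S y n) : splitCell S z n = splitCell S y n := by
  induction n with
  | zero => rfl
  | succ n ih =>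
    rw [splitCell] at h
    have hz : z ∈ splitCell S y n := by
      split_ifs at h
      exacts [h.1, h.1]
    rw [splitCell, splitCell, ih hz]
    by_cases hy : y ∈ S n (splitCell S y n)
    · rw [if_pos hy] at h
      rw [if_pos hy, if_pos h.2]
    · rw [if_neg hy] at h
      rw [if_neg hy, if_neg h.2]

theorem splitCode_eq_of_mem_branchCell (S : ℕ → Set K → Set K) {y : K} {x : ℕ → Bool}
    (h : ∀ n, y ∈ branchCell S x n) : splitCode S y = x := by
  have hcell (n : ℕ) : splitCell S y n = branchCell S x n ∧
      (splitCell S y n = branchCell S x n → splitCode S y n = x n) := by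
    induction n with
    | zero =>
      refine ⟨rfl, fun e => ?_⟩
      have h1 := h 1
      rw [branchCell] at h1
      rw [splitCode, e]
      cases hx : x 0 <;> simp_all
    | succ n ih =>
      have hn := ih.2 ih.1
      refine ⟨?_, fun e => ?_⟩
      · rw [splitCell, branchCell, ← hn, ← ih.1]
        rw [splitCode]
        by_cases h : y ∈ S n (splitCell S y n) <;> simp [h]
      · have h1 := h (n + 2)
        rw [branchCell] at h1
        rw [splitCode, e]
        cases hx : x (n + 1) <;> simp_all
  exact funext fun n => (hcell n).2 (hcell n).1

variable [TopologicalSpace K]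

/-- A compact space without isolated points whose points are separated by countably many clopen
sets is homeomorphic to the Cantor space. -/
theorem nonempty_homeomorph_nat_bool [CompactSpace K] [Nonempty K]
    (U : ℕ → Set K) (hU : ∀ n, IsClopen (U n))
    (hsep : ∀ y z, (∀ n, y ∈ U n ↔ z ∈ U n) → y = z)
    (hperf : ∀ (C : Set K) (y : K), IsOpen C → y ∈ C → ∃ z ∈ C, z ≠ y) :
    Nonempty (K ≃ₜ (ℕ → Bool)) := by
  -- Cut `C` by `U n` if that is a proper cut, otherwise by any `U m` that separates two points of
  -- `C`. Either way both halves are nonempty and membership in `U n` is constant on each.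
  have hsplit (n : ℕ) (C : Set K) : ∃ S : Set K, IsClopen C → C.Nonempty →
      IsClopen S ∧ (C ∩ S).Nonempty ∧ (C \ S).Nonempty ∧
        (∀ y ∈ C, ∀ z ∈ C, (y ∈ S ↔ z ∈ S) → (y ∈ U n ↔ z ∈ U n)) := by
    by_cases h : (C ∩ U n).Nonempty ∧ (C \ U n).Nonempty
    · exact ⟨U n, fun _ _ => ⟨hU n, h.1, h.2, fun _ _ _ _ => id⟩⟩
    · by_cases hC : IsClopen C ∧ C.Nonempty
      · obtain ⟨hC, y, hy⟩ := hC
        obtain ⟨z, hz, hzy⟩ := hperf C y hC.isOpen hy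
        have hm : ∃ m, ¬(y ∈ U m ↔ z ∈ U m) := by
          by_contra! hm
          exact hzy (hsep y z hm).symm
        obtain ⟨m, hm⟩ := hm
        refine ⟨U m, fun _ _ => ⟨hU m, ?_, ?_, fun a ha b hb _ => ?_⟩⟩
        · by_cases hym : y ∈ U m
          · exact ⟨y, hy, hym⟩
          · exact ⟨z, hz, by tauto⟩
        · by_cases hym : y ∈ U m
          · exact ⟨z, hz, by tauto⟩
          · exact ⟨y, hy, hym⟩
        · by_contra hab
          refine h ?_
          by_cases haU : a ∈ U n
          · exact ⟨⟨a, ha, haU⟩, ⟨b, hb, by tauto⟩⟩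
          · exact ⟨⟨b, hb, by tauto⟩, ⟨a, ha, haU⟩⟩
      · exact ⟨∅, fun h1 h2 => (hC ⟨h1, h2⟩).elim⟩
  choose S hS using hsplit
  have hcell (y : K) (n : ℕ) : IsClopen (splitCell S y n) := by
    induction n with
    | zero => exact isClopen_univ
    | succ n ih =>
      have := (hS n _ ih ⟨y, mem_splitCell S y n⟩).1
      rw [splitCell]
      split_ifs
      exacts [ih.inter this, ih.diff this]
  have hScell (y : K) (n : ℕ) := hS n _ (hcell y n) ⟨y, mem_splitCell S y n⟩
  have hbranch (x : ℕ → Bool) (n : ℕ) :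
      IsClopen (branchCell S x n) ∧ (branchCell S x n).Nonempty := by
    induction n with
    | zero => exact ⟨isClopen_univ, univ_nonempty⟩
    | succ n ih =>
      obtain ⟨h1, h2, h3, -⟩ := hS n _ ih.1 ih.2
      rw [branchCell]
      split_ifs
      exacts [⟨ih.1.inter h1, h2⟩, ⟨ih.1.diff h1, h3⟩]
  have hcont : Continuous (splitCode S) := by
    refine continuous_pi fun n => (IsLocallyConstant.iff_exists_open _).2 (fun y => ?_) |>.continuous
    refine ⟨splitCell S y (n + 1), (hcell y (n + 1)).isOpen, mem_splitCell S y (n + 1),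
      fun z hz => ?_⟩
    have hzn : splitCell S z n = splitCell S y n := by
      refine splitCell_eq_of_mem S ?_
      rw [splitCell] at hz
      split_ifs at hz
      exacts [hz.1, hz.1]
    rw [splitCell] at hz
    simp only [splitCode, hzn, decide_eq_decide]
    split_ifs at hz with hy
    · exact ⟨fun _ => hy, fun _ => hz.2⟩
    · exact ⟨fun h => (hz.2 h).elim, fun h => (hy h).elim⟩
  have hinj : Function.Injective (splitCode S) := by
    intro y z hyz
    have hc (n : ℕ) : splitCell S y n = splitCell S z n := by
      rw [← branchCell_splitCode, hyz, branchCell_splitCode]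
    refine hsep y z fun n => (hScell y n).2.2.2 y (mem_splitCell S y n) z
      (hc n ▸ mem_splitCell S z n) ?_
    have := congrFun hyz n
    simpa only [splitCode, hc n, decide_eq_decide] using this
  have hsurj : Function.Surjective (splitCode S) := by
    intro x
    obtain ⟨y, hy⟩ := IsCompact.nonempty_iInter_of_sequence_nonempty_isCompact_isClosed
      (branchCell S x) (fun n => by
        rw [branchCell]
        split_ifs
        exacts [inter_subset_left, sdiff_subset])
      (fun n => (hbranch x n).2) isCompact_univ (fun n => (hbranch x n).1.isClosed)
    exact ⟨y, splitCode_eq_of_mem_branchCell S (mem_iInter.1 hy)⟩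
  exact ⟨hcont.homeoOfEquivCompactToT2 (f := Equiv.ofBijective _ ⟨hinj, hsurj⟩)⟩

end CantorSpace

/-! ### The patch topology is compact and Hausdorff. -/

namespace ZariskiRiemann

variable {F : Type*} [Field F]

theorem isClopen_setOf_mem (x : F) : IsClopen {V : ValuationSubring F | x ∈ V} := by
  refine ⟨⟨TopologicalSpace.isOpen_generateFrom_of_mem ⟨∅, {x}, ?_⟩⟩,
    TopologicalSpace.isOpen_generateFrom_of_mem ⟨{x}, ∅, ?_⟩⟩
  · ext V
    simp
  · ext V
    simp

instance : T2Space (ValuationSubring F) := by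
  refine ⟨fun V W hVW => ?_⟩
  have hx : ∃ x, ¬(x ∈ V ↔ x ∈ W) := by
    by_contra! h
    exact hVW (SetLike.ext h)
  obtain ⟨x, hx⟩ := hx
  have ho := isClopen_setOf_mem x
  by_cases hV : x ∈ V
  · exact ⟨_, _, ho.isOpen, ho.compl.isOpen, hV, fun h => hx ⟨fun _ => h, fun _ => hV⟩,
      disjoint_compl_right⟩
  · exact ⟨_, _, ho.compl.isOpen, ho.isOpen, hV, by_contra fun h => hx
      ⟨fun h' => (hV h').elim, fun h' => (h h').elim⟩, disjoint_compl_left⟩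

/-- The valuation ring to which an ultrafilter on the set of valuation rings converges. -/
def ultrafilterLimit (f : Ultrafilter (ValuationSubring F)) : ValuationSubring F where
  carrier := {x | ∀ᶠ V in (f : Filter (ValuationSubring F)), x ∈ V}
  mul_mem' ha hb := Eventually.mp ha (Eventually.mono hb fun _ h2 h1 => mul_mem h1 h2)
  add_mem' ha hb := Eventually.mp ha (Eventually.mono hb fun _ h2 h1 => add_mem h1 h2)
  one_mem' := Eventually.of_forall fun V => one_mem V
  zero_mem' := Eventually.of_forall fun V => zero_mem V
  neg_mem' ha := Eventually.mono ha fun _ h => neg_mem h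
  mem_or_inv_mem' x := Ultrafilter.eventually_or.1 <|
    Eventually.of_forall fun V => V.mem_or_inv_mem x

instance : CompactSpace (ValuationSubring F) := by
  refine ⟨isCompact_iff_ultrafilter_le_nhds.2 fun f _ => ⟨ultrafilterLimit f, mem_univ _, ?_⟩⟩
  rw [TopologicalSpace.nhds_generateFrom]
  refine le_iInf₂ fun s hs => le_principal_iff.2 ?_
  obtain ⟨hs, S, T, rfl⟩ := hs
  have h1 : ∀ᶠ V in (f : Filter (ValuationSubring F)), ∀ x ∈ S, x ∈ V :=
    (Finset.eventually_all S).2 hs.1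
  have h2 : ∀ᶠ V in (f : Filter (ValuationSubring F)), ∀ x ∈ T, x ∉ V :=
    (Finset.eventually_all T).2 fun x hx => Ultrafilter.eventually_not.2 (hs.2 x hx)
  exact h1.and h2

theorem mem_A {X : Set (ValuationSubring F)} {x : F} : x ∈ A X ↔ ∀ V ∈ X, x ∈ V := by
  simp [A, Subring.mem_iInf]

theorem mem_J {X : Set (ValuationSubring F)} {x : F} : x ∈ J X ↔ ∀ V ∈ X, x ∈ V.nonunits := by
  simp [J, NonUnitalSubring.mem_iInf]

theorem isClosed_setOf_mem_nonunits (t : F) :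
    IsClosed {V : ValuationSubring F | t ∈ V.nonunits} := by
  by_cases ht : t = 0
  · simp [ht]
  · simpa [ValuationSubring.mem_nonunits_iff_or, ht, compl_ofPred] using
      (isClopen_setOf_mem t⁻¹).compl.isClosed

theorem one_add_inv_mem {V : ValuationSubring F} {c : F} (hc : c ∈ V.nonunits) :
    (1 + c)⁻¹ ∈ V := by
  rw [← V.valuation_le_one_iff, map_inv₀, V.valuation.map_one_add_of_lt hc, inv_one]

theorem IsRepresentation.exists_ne {R : Subring F} {X : Set (ValuationSubring F)}
    (hX : IsRepresentation X R) (hval : ¬IsValuationRingOf R) (V : ValuationSubring F) :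
    ∃ W ∈ X, W ≠ V := by
  by_contra! h
  rcases eq_empty_or_nonempty X with rfl | ⟨W, hW⟩
  · refine hval ⟨⊤, ?_⟩
    rw [hX]
    ext x
    simp [mem_A]
  · refine hval ⟨V, ?_⟩
    rw [hX]
    ext x
    rw [mem_A]
    exact ⟨fun hx U hU => h U hU ▸ hx, fun hx => h W hW ▸ hx W hW⟩

/-! ### Removing points from a representation of a local ring. -/

section Local

variable {R : Subring F} [IsLocalRing R]

/-- If `c = t * b ^ n` were outside `V`, then `(1 + c)⁻¹` would lie in `R`, and by locality it or `1
- (1 + c)⁻¹ = c * (1 + c)⁻¹` would be a unit. The first puts `1 + c` in `V`; the second makes `c` a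
unit in some `W ≠ V` of `X`, where it is a nonunit. -/
theorem mul_pow_mem_of_mem_diff (hval : ¬IsValuationRingOf R) {X : Set (ValuationSubring F)}
    (hX : IsRepresentation X R) {t : F} (ht : ∀ V ∈ X, t ∈ V.nonunits) (V : ValuationSubring F)
    {b : F} (hb : ∀ W ∈ X \ {V}, b ∈ W) (n : ℕ) (hV : V ∈ X) : t * b ^ n ∈ V := by
  by_contra hc
  have hcW : ∀ W ∈ X \ {V}, t * b ^ n ∈ W.nonunits := fun W hW => by
    have h1 : W.valuation t < 1 := ht W hW.1
    have h2 : W.valuation (b ^ n) ≤ 1 := (W.valuation_le_one_iff _).2 (pow_mem (hb W hW) n)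
    change W.valuation _ < 1
    rw [map_mul]
    exact mul_lt_one_of_lt_of_le h1 h2
  generalize t * b ^ n = c at hc hcW
  have hc1 : 1 + c ∉ V := fun h => hc (by simpa using sub_mem h (one_mem V))
  have hc0 : 1 + c ≠ 0 := fun h => hc1 (h ▸ zero_mem V)
  have he : (1 + c)⁻¹ ∈ R := by
    rw [hX, mem_A]
    intro W hW
    by_cases hWV : W = V
    · subst hWV
      exact (W.mem_or_inv_mem _).resolve_left hc1
    · exact one_add_inv_mem (hcW W ⟨hW, hWV⟩)
  rcases IsLocalRing.isUnit_or_isUnit_one_sub_self (⟨_, he⟩ : R) with h | h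
  · obtain ⟨u, hu⟩ := h.exists_right_inv
    have hu' : (1 + c)⁻¹ * (u : F) = 1 := congrArg Subtype.val hu
    have hcu : (u : F) = 1 + c := by
      field_simp at hu'
      exact hu'
    have := u.2
    rw [hcu, hX, mem_A] at this
    exact hc1 (this V hV)
  · obtain ⟨u, hu⟩ := h.exists_right_inv
    have hu' : (1 - (1 + c)⁻¹) * (u : F) = 1 := congrArg Subtype.val hu
    have hcu : c * ((1 + c)⁻¹ * (u : F)) = 1 := by
      have h1 : 1 - (1 + c)⁻¹ = c * (1 + c)⁻¹ := by
        field_simp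
        ring
      rw [← mul_assoc, ← h1, hu']
    obtain ⟨W, hW, hWV⟩ := hX.exists_ne hval V
    have hR (V : ValuationSubring F) (hV : V ∈ X) {x : F} (hx : x ∈ R) : x ∈ V := by
      rw [hX, mem_A] at hx
      exact hx V hV
    have h1 : W.valuation c < 1 := hcW W ⟨hW, hWV⟩
    have h2 : W.valuation ((1 + c)⁻¹ * (u : F)) ≤ 1 := (W.valuation_le_one_iff _).2
      (mul_mem (one_add_inv_mem (hcW W ⟨hW, hWV⟩)) (hR W hW u.2))
    have h3 := mul_lt_one_of_lt_of_le h1 h2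
    rw [← map_mul, hcu, map_one] at h3
    exact h3.false

theorem IsRepresentation.diff_singleton (hcic : IsCompletelyIntegrallyClosed R)
    (hval : ¬IsValuationRingOf R) {X : Set (ValuationSubring F)} (hX : IsRepresentation X R)
    {t : F} (ht0 : t ≠ 0) (ht : ∀ V ∈ X, t ∈ V.nonunits) (V : ValuationSubring F) :
    IsRepresentation (X \ {V}) R := by
  refine le_antisymm (fun x hx => ?_) fun b hb => ?_
  · rw [hX, mem_A] at hx
    exact mem_A.2 fun W hW => hx W hW.1
  · rw [mem_A] at hb
    have hmem (n : ℕ) : t * b ^ n ∈ R := by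
      rw [hX, mem_A]
      intro W hW
      by_cases hWV : W = V
      · subst hWV
        exact mul_pow_mem_of_mem_diff hval hX ht W hb n hW
      · exact mul_mem (ValuationSubring.nonunits_subset (ht W hW)) (pow_mem (hb W ⟨hW, hWV⟩) n)
    have htR : t ∈ R := by simpa using hmem 0
    refine hcic b ?_ ⟨⟨t, htR⟩, ?_, fun n => ⟨⟨_, hmem n⟩, rfl⟩⟩
    · have h1 : t * b ∈ R := by simpa using hmem 1
      have := div_mem (Subfield.subset_closure (s := (R : Set F)) h1)
        (Subfield.subset_closure (s := (R : Set F)) htR)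
      rwa [mul_div_cancel_left₀ b ht0] at this
    · exact mem_nonZeroDivisors_of_ne_zero fun h => ht0 (congrArg Subtype.val h)

theorem IsRepresentation.diff_finite (hcic : IsCompletelyIntegrallyClosed R)
    (hval : ¬IsValuationRingOf R) {X : Set (ValuationSubring F)} (hX : IsRepresentation X R)
    {t : F} (ht0 : t ≠ 0) (ht : ∀ V ∈ X, t ∈ V.nonunits) {S : Set (ValuationSubring F)}
    (hS : S.Finite) : IsRepresentation (X \ S) R := by
  induction S, hS using Set.Finite.induction_on with
  | empty => rwa [sdiff_empty]
  | @insert V S _ _ ih =>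
    rw [← union_singleton, ← sdiff_sdiff]
    exact ih.diff_singleton hcic hval ht0 (fun V hV => ht V hV.1) V

theorem mem_nonunits_of_mem_lim {X : Set (ValuationSubring F)} {t : F}
    (ht : ∀ V ∈ X, t ∈ V.nonunits) : ∀ V ∈ lim X, t ∈ V.nonunits := fun _ hV =>
  closure_minimal ht (isClosed_setOf_mem_nonunits t) (derivedSet_subset_closure X hV)

theorem IsRepresentation.lim (hcic : IsCompletelyIntegrallyClosed R)
    (hval : ¬IsValuationRingOf R) {X : Set (ValuationSubring F)} (hX : IsRepresentation X R)
    {t : F} (ht0 : t ≠ 0) (ht : ∀ V ∈ X, t ∈ V.nonunits) : IsRepresentation (lim X) R := by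
  refine le_antisymm (fun x hx => ?_) fun b hb => ?_
  · rw [hX, mem_A] at hx
    exact mem_A.2 fun V hV => closure_minimal hx (isClopen_setOf_mem x).isClosed
      (derivedSet_subset_closure X hV)
  · rw [mem_A] at hb
    -- Infinitely many members omitting `b` would accumulate at a limit point omitting `b`.
    have hfin : (X ∩ {V | b ∈ V}ᶜ).Finite := by
      by_contra hinf
      obtain ⟨V, hV, hacc⟩ := Set.Infinite.exists_accPt_of_subset_isCompact hinf
        (isClopen_setOf_mem b).compl.isClosed.isCompact inter_subset_right
      exact hV (hb V (derivedSet_mono _ _ inter_subset_left hacc))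
    have h : R = A _ := hX.diff_finite hcic hval ht0 ht hfin
    rw [h, mem_A]
    intro V hV
    by_contra hbV
    exact hV.2 ⟨hV.1, hbV⟩

end Local

theorem IsRepresentation.sInter {R : Subring F} {c : Set (Set (ValuationSubring F))}
    (hc : IsChain (· ⊆ ·) c) (hne : c.Nonempty)
    (h : ∀ Y ∈ c, IsClosed Y ∧ IsRepresentation Y R) : IsRepresentation (⋂₀ c) R := by
  refine le_antisymm (fun x hx => ?_) fun b hb => ?_
  · obtain ⟨Y, hY⟩ := hne
    rw [(h Y hY).2, mem_A] at hx
    exact mem_A.2 fun V hV => hx V (hV Y hY)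
  · rw [mem_A] at hb
    by_contra hbR
    have : Nonempty c := hne.to_subtype
    have hcl (Y : c) : IsClosed ((Y : Set (ValuationSubring F)) ∩ {V | b ∈ V}ᶜ) :=
      (h Y Y.2).1.inter (isClopen_setOf_mem b).compl.isClosed
    obtain ⟨V, hV⟩ := IsCompact.nonempty_iInter_of_directed_nonempty_isCompact_isClosed
      (fun Y : c => (Y : Set (ValuationSubring F)) ∩ {V | b ∈ V}ᶜ)
      (fun Y Z => by
        rcases hc.total Y.2 Z.2 with hYZ | hZY
        · exact ⟨Y, subset_rfl, inter_subset_inter_left _ hYZ⟩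
        · exact ⟨Z, inter_subset_inter_left _ hZY, subset_rfl⟩)
      (fun Y => by
        by_contra hemp
        refine hbR ?_
        rw [(h Y Y.2).2, mem_A]
        intro V hV
        by_contra hbV
        exact hemp ⟨V, hV, hbV⟩)
      (fun Y => (hcl Y).isCompact) hcl
    rw [mem_iInter] at hV
    exact (hV ⟨_, hne.some_mem⟩).2 (hb V fun Y hY => (hV ⟨Y, hY⟩).1)

theorem nonempty_homeomorph_cantorSet [Countable F] {Y : Set (ValuationSubring F)}
    (hY : Perfect Y) (hne : Y.Nonempty) : Nonempty (Y ≃ₜ cantorSet) := by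
  obtain ⟨f, hf⟩ := exists_surjective_nat F
  have : CompactSpace Y := isCompact_iff_compactSpace.1 hY.closed.isCompact
  have : Nonempty Y := hne.to_subtype
  have hclopen (n : ℕ) : IsClopen {V : Y | f n ∈ V.1} :=
    (isClopen_setOf_mem (f n)).preimage continuous_subtype_val
  obtain ⟨e⟩ := nonempty_homeomorph_nat_bool (fun n => {V : Y | f n ∈ V.1}) hclopen
    (fun V W h => Subtype.ext <| SetLike.ext <| hf.forall.2 h)
    (fun C V hC hV => by
      obtain ⟨O, hO, rfl⟩ := isOpen_induced_iff.1 hC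
      obtain ⟨W, hW, hWV⟩ := accPt_iff_nhds.1 (hY.acc V.1 V.2) O (hO.mem_nhds hV)
      exact ⟨⟨W, hW.2⟩, hW.1, fun h => hWV (congrArg Subtype.val h)⟩)
  exact ⟨e.trans cantorSetHomeomorphNatToBool.symm⟩

end ZariskiRiemann

open ZariskiRiemann in
theorem exists_perfect_representation {F : Type*} [Field F] {R : Subring F} [IsLocalRing R]
    (hcic : IsCompletelyIntegrallyClosed R) (hval : ¬IsValuationRingOf R)
    {X : Set (ValuationSubring F)} (hX : IsRepresentation X R) {t : F} (ht0 : t ≠ 0)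
    (ht : ∀ V ∈ X, t ∈ V.nonunits) : ∃ Y ⊆ lim X, Perfect Y ∧ IsRepresentation Y R := by
  obtain ⟨Y, hYX, hY, hmin⟩ := zorn_superset_nonempty
    {Y : Set (ValuationSubring F) | IsClosed Y ∧ IsRepresentation Y R}
    (fun c hc hchain hne => ⟨⋂₀ c, ⟨isClosed_sInter fun Y hY => (hc hY).1,
      IsRepresentation.sInter hchain hne hc⟩, fun Y hY => sInter_subset_of_mem hY⟩)
    (lim X) ⟨isClosed_derivedSet X, hX.lim hcic hval ht0 ht⟩
  refine ⟨Y, hYX, perfect_iff_eq_derivedSet.2 ?_, hY.2⟩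
  have hsub : derivedSet Y ⊆ Y := (isClosed_iff_derivedSet_subset Y).1 hY.1
  -- `t` stays in all maximal ideals over `lim X`, so the limit theorem applies to `Y` itself.
  exact (hmin ⟨isClosed_derivedSet Y, hY.2.lim hcic hval ht0 fun V hV =>
    mem_nonunits_of_mem_lim ht V (hYX hV)⟩ hsub).antisymm hsub

theorem corollary3p6 {F : Type*} [Field F] [Countable F] (R : Subring F) [IsLocalRing R]
    (hcic : ZariskiRiemann.IsCompletelyIntegrallyClosed R)
    (hval : ¬ ZariskiRiemann.IsValuationRingOf R)
    (X : Set (ValuationSubring F)) (hX : ZariskiRiemann.IsRepresentation X R)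
    (hJ : ZariskiRiemann.J X ≠ ⊥) :
    ∃ Y : Set (ValuationSubring F), Y ⊆ ZariskiRiemann.lim X ∧ IsClosed Y ∧
      ZariskiRiemann.IsRepresentation Y R ∧ Nonempty (Y ≃ₜ cantorSet) := by
  obtain ⟨t, ht, ht0⟩ : ∃ t ∈ ZariskiRiemann.J X, t ≠ 0 := by
    by_contra! h
    exact hJ (eq_bot_iff.2 fun t ht => NonUnitalSubring.mem_bot.2 (h t ht))
  obtain ⟨Y, hYX, hperf, hY⟩ :=
    exists_perfect_representation hcic hval hX ht0 (ZariskiRiemann.mem_J.1 ht)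
  -- Only nonemptiness of `Y` is wanted; `⊤` is an arbitrary choice.
  obtain ⟨V, hV, -⟩ := hY.exists_ne hval ⊤
  exact ⟨Y, hYX, hperf.closed, hY, ZariskiRiemann.nonempty_homeomorph_cantorSet hperf ⟨V, hV⟩⟩
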